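/- Let $p \ge 0$ and $n \ge 1$ be integers, let $L_p > 0$, and let $f_p : \mathbb{R}^p \to \mathbb{R}$ be a function that is convex or concave and $L_p$-Lipschitz with respect to the Euclidean norm. Let $X$ be a random vector in $\mathbb{R}^p$ whose coordinates are independent and each almost surely lie in $[0,1]$, and let $X_1, \dots, X_n$ be independent and identically distributed copies of $X$. Then $f_p(X)$ is integrable, and the following hold. 1. For every $\delta \ge 0$, $$\mathbb{P}\left\{ \left| \frac1n\sum_{i=1}^n f_p(X_i) - E[f_p(X)] \right| > \delta \right\} \le 2\exp\left(-\frac{\delta^2 n}{2L_p^2}\right).$$ 2. For every $\alpha \in (0,1)$, the interval $$\left( \frac1n\sum_{i=1}^n f_p(X_i) - \sqrt{\frac{2\log(2/\alpha)L_p^2}{n}},\ \ \frac1n\sum_{i=1}^n f_p(X_i) + \sqrt{\frac{2\log(2/\alpha)L_p^2}{n}} \right)$$ is a non-asymptotic $1-\alpha$ confidence interval for $E[f_p(X)]$, that is, this open interval contains $E[f_p(X)]$ with probability at least $1-\alpha$. 3. If $E[f_p(X)] \neq 0$, then for every $\delta \ge 0$, $$\mathbb{P}\left\{ \left| \frac{\frac1n\sum_{i=1}^n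 f_p(X_i) - E[f_p(X)]}{E[f_p(X)]} \right| > \delta \right\} \le 2\exp\left(-\frac{\delta^2 n\, E[f_p(X)]^2}{2L_p^2}\right).$$ -/

import Mathlib

open MeasureTheory ProbabilityTheory
open scoped NNReal

/-! Dimension-free concentration comes from a dual weak transport inequality with quadratic cost, as
in Talagrand's convex-distance method. On the line, a point `x` of `[0,1]` is compared with one
moved towards a minimiser of the convex `f` (`weakTransport_real`). Infimal convolution adds one
coordinate at a time without loss (`WeakTransport.prod`), so the product law satisfies it with the
squared Euclidean distance over 2.

Since `L d ≤ d²/2 + L²/2`, the choice `g = f - L²/2` is admissible. Applied to `t f`, the two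
inequalities bound the moment generating function for both signs, so `f(X)` is sub-Gaussian with
proxy `L²`. Hoeffding's bound for the copies then gives the three claims. -/

/-! ### Integrability of Lipschitz functions under boundedly supported measures -/

section Integrability

variable {E : Type*} [NormedAddCommGroup E] [MeasurableSpace E]

/-- The measure is concentrated on a bounded set. -/
def BoundedlySupported (ν : Measure E) : Prop := ∃ R : ℝ, ∀ᵐ x ∂ν, ‖x‖ ≤ R

theorem BoundedlySupported.ae_norm_le {ν : Measure E} (hν : BoundedlySupported ν)
    {K : ℝ≥0} {f : E → ℝ} (hf : LipschitzWith K f) : ∃ C : ℝ, ∀ᵐ x ∂ν, |f x| ≤ C := by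
  obtain ⟨R, hR⟩ := hν
  refine ⟨|f 0| + K * R, hR.mono fun x hx => ?_⟩
  have h1 := hf.dist_le_mul x 0
  rw [Real.dist_eq, dist_zero_right] at h1
  have h2 : |f x| ≤ |f x - f 0| + |f 0| := by
    simpa using abs_add_le (f x - f 0) (f 0)
  have h3 : (K : ℝ) * ‖x‖ ≤ K * R := by gcongr
  linarith

theorem BoundedlySupported.integrable [BorelSpace E] [SecondCountableTopology E] {ν : Measure E}
    [IsFiniteMeasure ν] (hν : BoundedlySupported ν) {K : ℝ≥0} {f : E → ℝ} (hf : LipschitzWith K f) :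
    Integrable f ν := by
  obtain ⟨C, hC⟩ := hν.ae_norm_le hf
  exact Integrable.of_bound hf.continuous.aestronglyMeasurable C hC

theorem BoundedlySupported.integrable_exp [BorelSpace E] [SecondCountableTopology E] {ν : Measure E}
    [IsFiniteMeasure ν] (hν : BoundedlySupported ν) {K : ℝ≥0} {f : E → ℝ} (hf : LipschitzWith K f) :
    Integrable (fun x => Real.exp (f x)) ν := by
  obtain ⟨C, hC⟩ := hν.ae_norm_le hf
  refine Integrable.of_bound
    (Real.continuous_exp.comp hf.continuous).aestronglyMeasurable (Real.exp C) ?_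
  refine hC.mono fun x hx => ?_
  rw [Real.norm_eq_abs, Real.abs_exp]
  exact Real.exp_le_exp.2 ((le_abs_self _).trans hx)

theorem BoundedlySupported.of_ae_mem_Icc {μ : Measure ℝ}
    (hμ : ∀ᵐ x ∂μ, x ∈ Set.Icc (0 : ℝ) 1) : BoundedlySupported μ :=
  ⟨1, hμ.mono fun x hx => by rw [Real.norm_eq_abs, abs_le]; constructor <;> linarith [hx.1, hx.2]⟩

theorem BoundedlySupported.prod {F : Type*} [NormedAddCommGroup F] [MeasurableSpace F]
    {μ : Measure E} {ν : Measure F} [SFinite μ] [SFinite ν] (hμ : BoundedlySupported μ)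
    (hν : BoundedlySupported ν) : BoundedlySupported (μ.prod ν) := by
  obtain ⟨R, hR⟩ := hμ
  obtain ⟨S, hS⟩ := hν
  refine ⟨max R S, ?_⟩
  filter_upwards [Measure.quasiMeasurePreserving_fst.ae hR,
    Measure.quasiMeasurePreserving_snd.ae hS] with x h1 h2
  exact max_le_max h1 h2

theorem BoundedlySupported.pi {ι : Type*} [Fintype ι] {μ : ι → Measure ℝ}
    [∀ i, IsProbabilityMeasure (μ i)] (hμ : ∀ i, ∀ᵐ x ∂μ i, x ∈ Set.Icc (0 : ℝ) 1) :
    BoundedlySupported (Measure.pi μ) := by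
  refine ⟨1, ?_⟩
  have h : ∀ᵐ x ∂Measure.pi μ, ∀ i, x i ∈ Set.Icc (0 : ℝ) 1 :=
    ae_all_iff.2 fun i => (Measure.quasiMeasurePreserving_eval μ i).ae (hμ i)
  refine h.mono fun x hx => (pi_norm_le_iff_of_nonneg zero_le_one).2 fun i => ?_
  rw [Real.norm_eq_abs, abs_le]
  constructor <;> linarith [(hx i).1, (hx i).2]

end Integrability

theorem LipschitzWith.integral_param {E S : Type*} [MeasurableSpace E] [PseudoMetricSpace S]
    {ν : Measure E} [IsProbabilityMeasure ν] {K : ℝ≥0} {f : S → E → ℝ}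
    (hint : ∀ s, Integrable (f s) ν) (hf : ∀ x, LipschitzWith K (fun s => f s x)) :
    LipschitzWith K (fun s => ∫ x, f s x ∂ν) := by
  refine LipschitzWith.of_le_add_mul K fun s t => ?_
  calc ∫ x, f s x ∂ν ≤ ∫ x, (f t x + K * dist s t) ∂ν := by
        refine integral_mono (hint s) ((hint t).add (integrable_const _)) fun x => ?_
        have := (hf x).dist_le_mul s t
        rw [Real.dist_eq] at this
        have := le_abs_self (f s x - f t x)
        simp only []
        linarith
    _ = ∫ x, f t x ∂ν + K * dist s t := by
        rw [integral_add (hint t) (integrable_const _)]; simp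

theorem ConvexOn.integral_param {E S : Type*} [MeasurableSpace E] [AddCommGroup S] [Module ℝ S]
    {ν : Measure E} {f : S → E → ℝ} (hint : ∀ s, Integrable (f s) ν)
    (hf : ∀ x, ConvexOn ℝ Set.univ (fun s => f s x)) :
    ConvexOn ℝ Set.univ (fun s => ∫ x, f s x ∂ν) := by
  refine ⟨convex_univ, fun s _ t _ a b ha hb hab => ?_⟩
  simp only [smul_eq_mul]
  rw [← integral_const_mul, ← integral_const_mul,
    ← integral_add ((hint s).const_mul a) ((hint t).const_mul b)]
  exact integral_mono (hint _) (((hint s).const_mul a).add ((hint t).const_mul b))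
    fun x => (hf x).2 (Set.mem_univ s) (Set.mem_univ t) ha hb hab

/-! ### Weak transport inequalities in dual form -/

/-- The dual form of the two weak transport inequalities for the cost `c`, restricted to convex
Lipschitz functions. -/
def WeakTransport {E : Type*} [NormedAddCommGroup E] [NormedSpace ℝ E] [MeasurableSpace E]
    (c : E → E → ℝ) (ν : Measure E) : Prop :=
  ∀ (K : ℝ≥0) (f g : E → ℝ), LipschitzWith K f → LipschitzWith K g → ConvexOn ℝ Set.univ f →
    (∀ x y, g x ≤ f y + c x y) →
    ∫ x, Real.exp (g x) ∂ν ≤ Real.exp (∫ x, f x ∂ν) ∧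
    ∫ x, Real.exp (-f x) ∂ν ≤ Real.exp (-∫ x, g x ∂ν)

/-- The first bound rests on `log (1 + v) ≥ 2v / (v + 2)`, the second on `exp (-v) ≤ 1 - v + v²/2`
for `v ≤ 1` and on `exp (-1) ≤ 2/5` beyond. -/
theorem exp_le_one_add_and_le_one_sub_exp {v w : ℝ} (hv : 0 ≤ v)
    (h1 : v ≤ 1 → w ≤ v - v ^ 2 / 2) (h2 : 1 ≤ v → w ≤ 1 / 2) :
    Real.exp w ≤ 1 + v ∧ w ≤ 1 - Real.exp (-v) := by
  have hlog : w ≤ Real.log (1 + v) := by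
    refine le_trans ?_ (Real.le_log_one_add_of_nonneg hv)
    rw [le_div_iff₀ (by positivity)]
    rcases le_total v 1 with h | h
    · nlinarith [h1 h, mul_le_mul_of_nonneg_right (h1 h) (by positivity : 0 ≤ v + 2),
        pow_nonneg hv 3]
    · nlinarith [h2 h]
  refine ⟨(Real.le_log_iff_exp_le (by positivity)).1 hlog, ?_⟩
  have key : ∀ u : ℝ, 0 ≤ u → Real.exp (-u) * (1 + u + u ^ 2 / 2) ≤ 1 := fun u hu => by
    have := mul_le_mul_of_nonneg_left (Real.quadratic_le_exp_of_nonneg hu) (Real.exp_pos (-u)).le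
    rwa [← Real.exp_add, neg_add_cancel, Real.exp_zero] at this
  rcases le_total v 1 with h | h
  · have h3 := key v hv
    have h4 : (1 : ℝ) ≤ (1 - v + v ^ 2 / 2) * (1 + v + v ^ 2 / 2) := by nlinarith [pow_nonneg hv 4]
    have h5 : Real.exp (-v) ≤ 1 - v + v ^ 2 / 2 :=
      le_of_mul_le_mul_right (h3.trans h4) (by positivity)
    linarith [h1 h]
  · have h3 := key 1 zero_le_one
    have h4 : Real.exp (-v) ≤ Real.exp (-1) := Real.exp_le_exp.2 (by linarith)
    linarith [h2 h]

/-- With excess `v = f x - f z`, test `hgf` at the point a fraction `v` of the way from `x` to `z`: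
convexity gains `v²` and the cost is at most `v²/2`. If `v ≥ 1`, go all the way to `z`. -/
theorem le_of_convexOn_of_le_add_sq {f g : ℝ → ℝ} (hf : ConvexOn ℝ Set.univ f)
    (hgf : ∀ x y, g x ≤ f y + (x - y) ^ 2 / 2) {x z : ℝ} (hxz : (x - z) ^ 2 ≤ 1)
    (hz : f z ≤ f x) :
    Real.exp (g x - f z) ≤ 1 + (f x - f z) ∧ g x - f z ≤ 1 - Real.exp (-(f x - f z)) := by
  set v := f x - f z with hv
  have hv0 : 0 ≤ v := sub_nonneg.2 hz
  refine exp_le_one_add_and_le_one_sub_exp hv0 (fun h => ?_) fun _ => ?_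
  · have h1 := hf.2 (Set.mem_univ x) (Set.mem_univ z) (sub_nonneg.2 h) hv0 (by ring)
    have h2 := hgf x ((1 - v) • x + v • z)
    simp only [smul_eq_mul] at h1 h2
    have h3 : (x - ((1 - v) * x + v * z)) ^ 2 = v ^ 2 * (x - z) ^ 2 := by ring
    have h4 : v ^ 2 * (x - z) ^ 2 ≤ v ^ 2 := mul_le_of_le_one_right (sq_nonneg v) hxz
    have h5 : f x = v + f z := by rw [hv]; ring
    rw [h3] at h2
    rw [h5] at h1
    nlinarith
  · linarith [hgf x z]

theorem weakTransport_real {μ : Measure ℝ} [IsProbabilityMeasure μ]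
    (hμ : ∀ᵐ x ∂μ, x ∈ Set.Icc (0 : ℝ) 1) :
    WeakTransport (fun x y : ℝ => (x - y) ^ 2 / 2) μ := by
  intro K f g hfK hgK hf hgf
  have hb := BoundedlySupported.of_ae_mem_Icc hμ
  -- Minimising over `[0,1]` only ensures existence and keeps `z` within distance 1 of almost every
  -- `x`.
  obtain ⟨z, hz, hmin⟩ := isCompact_Icc.exists_isMinOn (Set.nonempty_Icc.2 zero_le_one)
    hfK.continuous.continuousOn (s := Set.Icc (0 : ℝ) 1)
  have hpt : ∀ᵐ x ∂μ, Real.exp (g x - f z) ≤ 1 + (f x - f z) ∧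
      g x - f z ≤ 1 - Real.exp (-(f x - f z)) := hμ.mono fun x hx =>
    le_of_convexOn_of_le_add_sq hf hgf (by nlinarith [hx.1, hx.2, hz.1, hz.2]) (hmin hx)
  have hfi := hb.integrable hfK
  have hgi := hb.integrable hgK
  constructor
  · have hle : ∫ x, Real.exp (g x) ∂μ ≤ ∫ x, Real.exp (f z) * (1 + (f x - f z)) ∂μ := by
      refine integral_mono_ae (hb.integrable_exp hgK) (by fun_prop) (hpt.mono fun x hx => ?_)
      calc Real.exp (g x) = Real.exp (f z) * Real.exp (g x - f z) := by
            rw [← Real.exp_add]; ring_nf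
        _ ≤ _ := mul_le_mul_of_nonneg_left hx.1 (Real.exp_pos _).le
    have heq : ∫ x, Real.exp (f z) * (1 + (f x - f z)) ∂μ
        = Real.exp (f z) * ((∫ x, f x ∂μ - f z) + 1) := by
      rw [integral_const_mul, integral_add (by fun_prop) (by fun_prop),
        integral_sub hfi (by fun_prop)]
      simp [add_comm]
    refine hle.trans (heq.trans_le ?_)
    calc _ ≤ Real.exp (f z) * Real.exp (∫ x, f x ∂μ - f z) := by
          gcongr; exact Real.add_one_le_exp _
      _ = _ := by rw [← Real.exp_add]; ring_nf
  · have hei : Integrable (fun x => Real.exp (-f x)) μ := hb.integrable_exp hfK.neg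
    have heq : ∀ x, Real.exp (-(f x - f z)) = Real.exp (f z) * Real.exp (-f x) := fun x => by
      rw [← Real.exp_add]; ring_nf
    have hle : ∫ x, (g x - f z) ∂μ ≤ ∫ x, (1 - Real.exp (f z) * Real.exp (-f x)) ∂μ := by
      refine integral_mono_ae (by fun_prop) (by fun_prop) (hpt.mono fun x hx => ?_)
      simp only [← heq]
      exact hx.2
    rw [integral_sub hgi (by fun_prop), integral_sub (by fun_prop) (by fun_prop),
      integral_const_mul] at hle
    simp only [integral_const, probReal_univ, one_smul] at hle
    set I := ∫ x, Real.exp (-f x) ∂μ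
    have h1 : Real.exp (f z) * I ≤ Real.exp (f z - ∫ x, g x ∂μ) := by
      linarith [Real.add_one_le_exp (f z - ∫ x, g x ∂μ)]
    rw [sub_eq_add_neg, Real.exp_add] at h1
    exact le_of_mul_le_mul_left h1 (Real.exp_pos _)

/-! ### Infimal convolution in one real variable -/

/-- Infimal convolution of `f` with `r ↦ r ^ 2 / 2` in the first variable. -/
noncomputable def infConvFst {E : Type*} (f : ℝ × E → ℝ) (q : ℝ × E) : ℝ :=
  ⨅ r : ℝ, (f (q.1 + r, q.2) + r ^ 2 / 2)

theorem le_infConvFst {E : Type*} {f : ℝ × E → ℝ} {s : ℝ} {x : E} {a : ℝ}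
    (h : ∀ t, a ≤ f (t, x) + (s - t) ^ 2 / 2) : a ≤ infConvFst f (s, x) :=
  le_ciInf fun r => (h (s + r)).trans (le_of_eq (by ring))

section InfConv

variable {E : Type*} [NormedAddCommGroup E]

theorem bddBelow_infConvFst {K : ℝ≥0} {f : ℝ × E → ℝ} (hf : LipschitzWith K f) (q : ℝ × E) :
    BddBelow (Set.range fun r : ℝ => f (q.1 + r, q.2) + r ^ 2 / 2) := by
  -- The minimum of `r²/2 - K|r|` is `-K²/2`.
  refine ⟨f q - K ^ 2 / 2, ?_⟩
  rintro _ ⟨r, rfl⟩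
  have h1 := hf.dist_le_mul q (q.1 + r, q.2)
  have h2 : dist q (q.1 + r, q.2) = |r| := by
    rw [Prod.dist_eq]; simp
  rw [h2, Real.dist_eq] at h1
  have h3 := le_abs_self (f q - f (q.1 + r, q.2))
  have h4 := sq_abs r
  simp only []
  nlinarith [sq_nonneg (|r| - K)]

theorem infConvFst_le {K : ℝ≥0} {f : ℝ × E → ℝ} (hf : LipschitzWith K f) (s t : ℝ) (x : E) :
    infConvFst f (s, x) ≤ f (t, x) + (s - t) ^ 2 / 2 := by
  have h := ciInf_le (bddBelow_infConvFst hf (s, x)) (t - s)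
  simp only [add_sub_cancel] at h
  refine h.trans (le_of_eq ?_)
  ring

/-- Using the same increment `r` at both points preserves their distance, hence the constant. -/
theorem lipschitzWith_infConvFst {K : ℝ≥0} {f : ℝ × E → ℝ} (hf : LipschitzWith K f) :
    LipschitzWith K (infConvFst f) := by
  refine LipschitzWith.of_le_add_mul K fun q q' => ?_
  rw [← sub_le_iff_le_add]
  refine le_ciInf fun r => ?_
  have h1 := ciInf_le (bddBelow_infConvFst hf q) r
  have h2 := hf.dist_le_mul (q.1 + r, q.2) (q'.1 + r, q'.2)
  have h3 : dist (q.1 + r, q.2) (q'.1 + r, q'.2) = dist q q' := by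
    simp [Prod.dist_eq]
  rw [h3, Real.dist_eq] at h2
  have h4 := le_abs_self (f (q.1 + r, q.2) - f (q'.1 + r, q'.2))
  change infConvFst f q ≤ _ at h1
  linarith

/-- Partial minimisation of a function jointly convex in the point and the increment; the infimum is
handled through `ε`-minimisers. -/
theorem convexOn_infConvFst [NormedSpace ℝ E] {K : ℝ≥0} {f : ℝ × E → ℝ} (hf : LipschitzWith K f)
    (hc : ConvexOn ℝ Set.univ f) : ConvexOn ℝ Set.univ (infConvFst f) := by
  refine ⟨convex_univ, fun q _ q' _ a b ha hb hab => le_of_forall_pos_le_add fun ε hε => ?_⟩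
  obtain ⟨r, hr⟩ := exists_lt_of_ciInf_lt (lt_add_of_pos_right (infConvFst f q) hε)
  obtain ⟨r', hr'⟩ := exists_lt_of_ciInf_lt (lt_add_of_pos_right (infConvFst f q') hε)
  have h1 := ciInf_le (bddBelow_infConvFst hf (a • q + b • q')) (a * r + b * r')
  change infConvFst f _ ≤ _ at h1
  have h2 := hc.2 (Set.mem_univ (q.1 + r, q.2)) (Set.mem_univ (q'.1 + r', q'.2)) ha hb hab
  have h3 : a • (q.1 + r, q.2) + b • (q'.1 + r', q'.2)
      = ((a • q + b • q').1 + (a * r + b * r'), (a • q + b • q').2) := by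
    ext
    · simp; ring
    · simp
  rw [h3] at h2
  have h4 : (a * r + b * r') ^ 2 ≤ a * r ^ 2 + b * r' ^ 2 := by
    obtain rfl : b = 1 - a := by linarith
    nlinarith [mul_nonneg (mul_nonneg ha hb) (sq_nonneg (r - r'))]
  have h5 := mul_le_mul_of_nonneg_left hr.le ha
  have h6 := mul_le_mul_of_nonneg_left hr'.le hb
  have h7 : a * ε + b * ε = ε := by rw [← add_mul, hab, one_mul]
  simp only [smul_eq_mul] at h2 ⊢
  simp only [mul_add] at h5 h6
  linarith

end InfConv

/-! ### Tensorization -/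

theorem LipschitzWith.prod_mk_left_real {α β : Type*} [PseudoMetricSpace α] [PseudoMetricSpace β]
    {K : ℝ≥0} {f : α × β → ℝ} (hf : LipschitzWith K f) (s : α) :
    LipschitzWith K (fun x => f (s, x)) := by
  simpa [Function.comp_def] using hf.comp (LipschitzWith.prodMk_left s)

theorem LipschitzWith.prod_mk_right_real {α β : Type*} [PseudoMetricSpace α]
    [PseudoMetricSpace β] {K : ℝ≥0} {f : α × β → ℝ} (hf : LipschitzWith K f) (x : β) :
    LipschitzWith K (fun s => f (s, x)) := by
  simpa [Function.comp_def] using hf.comp (LipschitzWith.prodMk_right x)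

theorem ConvexOn.prod_mk_left {α β : Type*} [AddCommGroup α] [AddCommGroup β] [Module ℝ α]
    [Module ℝ β] {f : α × β → ℝ} (hf : ConvexOn ℝ Set.univ f) (s : α) :
    ConvexOn ℝ Set.univ (fun x => f (s, x)) := by
  refine ⟨convex_univ, fun x _ y _ a b ha hb hab => ?_⟩
  have h := hf.2 (Set.mem_univ (s, x)) (Set.mem_univ (s, y)) ha hb hab
  rwa [Prod.smul_mk, Prod.smul_mk, Prod.mk_add_mk, ← add_smul, hab, one_smul] at h

theorem ConvexOn.prod_mk_right {α β : Type*} [AddCommGroup α] [AddCommGroup β] [Module ℝ α]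
    [Module ℝ β] {f : α × β → ℝ} (hf : ConvexOn ℝ Set.univ f) (x : β) :
    ConvexOn ℝ Set.univ (fun s => f (s, x)) := by
  refine ⟨convex_univ, fun s _ t _ a b ha hb hab => ?_⟩
  have h := hf.2 (Set.mem_univ (s, x)) (Set.mem_univ (t, x)) ha hb hab
  rwa [Prod.smul_mk, Prod.smul_mk, Prod.mk_add_mk, ← add_smul, hab, one_smul] at h

/-- The function `h` splits the hypothesis into a move in `ℝ` from `f` to `h` and a move in `E` from
`h` to `g`, each covered by one factor's inequality. -/
theorem WeakTransport.prod {E : Type*} [NormedAddCommGroup E] [NormedSpace ℝ E]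
    [MeasurableSpace E] [BorelSpace E] [SecondCountableTopology E] {c : E → E → ℝ}
    {ν : Measure E} [IsProbabilityMeasure ν] (hνb : BoundedlySupported ν)
    (hν : WeakTransport c ν) {μ : Measure ℝ} [IsProbabilityMeasure μ]
    (hμ : ∀ᵐ x ∂μ, x ∈ Set.Icc (0 : ℝ) 1) :
    WeakTransport (fun q q' : ℝ × E => (q.1 - q'.1) ^ 2 / 2 + c q.2 q'.2) (μ.prod ν) := by
  intro K f g hfK hgK hf hgf
  have hμb := BoundedlySupported.of_ae_mem_Icc hμ
  have hb := hμb.prod hνb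
  set h := infConvFst f with hdef
  have hhK : LipschitzWith K h := lipschitzWith_infConvFst hfK
  have hh : ConvexOn ℝ Set.univ h := convexOn_infConvFst hfK hf
  have hhle : ∀ s t x, h (s, x) ≤ f (t, x) + (s - t) ^ 2 / 2 := infConvFst_le hfK
  have hgh : ∀ s x y, g (s, x) ≤ h (s, y) + c x y := fun s x y => by
    rw [← sub_le_iff_le_add]
    exact le_infConvFst fun t => by linarith [hgf (s, x) (t, y)]
  have hiν : ∀ {u : ℝ × E → ℝ}, LipschitzWith K u → ∀ s, Integrable (fun x => u (s, x)) ν :=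
    fun hu s => hνb.integrable (hu.prod_mk_left_real s)
  have hiμ : ∀ {u : ℝ × E → ℝ}, LipschitzWith K u → ∀ x, Integrable (fun s => u (s, x)) μ :=
    fun hu x => hμb.integrable (hu.prod_mk_right_real x)
  constructor
  -- Here `ν` acts first, at fixed `s`, on the pair `h`, `g`; then `μ` on the averages of `f` and
  -- `h`.
  · have hHK : LipschitzWith K (fun s => ∫ x, h (s, x) ∂ν) :=
      LipschitzWith.integral_param (hiν hhK) hhK.prod_mk_right_real
    have hFK : LipschitzWith K (fun s => ∫ x, f (s, x) ∂ν) :=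
      LipschitzWith.integral_param (hiν hfK) hfK.prod_mk_right_real
    have hF : ConvexOn ℝ Set.univ (fun s => ∫ x, f (s, x) ∂ν) :=
      ConvexOn.integral_param (hiν hfK) hf.prod_mk_right
    rw [integral_prod _ (hb.integrable_exp hgK), integral_prod _ (hb.integrable hfK)]
    refine le_trans (integral_mono (hb.integrable_exp hgK).integral_prod_left
      (hμb.integrable_exp hHK) fun s => ?_) (weakTransport_real hμ K _ _ hFK hHK hF ?_).1
    · exact (hν K _ _ (hhK.prod_mk_left_real s) (hgK.prod_mk_left_real s) (hh.prod_mk_left s)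
        (hgh s)).1
    · intro s t
      calc ∫ x, h (s, x) ∂ν ≤ ∫ x, (f (t, x) + (s - t) ^ 2 / 2) ∂ν :=
            integral_mono (hiν hhK s) ((hiν hfK t).add (integrable_const _)) (hhle s t)
        _ = _ := by rw [integral_add (hiν hfK t) (integrable_const _)]; simp
  -- The order is reversed: `μ` acts first on `f`, `h`, then `ν` on the averages of `h` and `g`.
  · have hHK : LipschitzWith K (fun x => ∫ s, h (s, x) ∂μ) :=
      LipschitzWith.integral_param (hiμ hhK) hhK.prod_mk_left_real
    have hGK : LipschitzWith K (fun x => ∫ s, g (s, x) ∂μ) :=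
      LipschitzWith.integral_param (hiμ hgK) hgK.prod_mk_left_real
    have hH : ConvexOn ℝ Set.univ (fun x => ∫ s, h (s, x) ∂μ) :=
      ConvexOn.integral_param (hiμ hhK) hh.prod_mk_left
    have hei : Integrable (fun q => Real.exp (-f q)) (μ.prod ν) := hb.integrable_exp hfK.neg
    rw [integral_prod_symm _ hei, integral_prod_symm _ (hb.integrable hgK)]
    refine le_trans (integral_mono hei.integral_prod_right
      (hνb.integrable_exp hHK.neg) fun x => ?_) (hν K _ _ hHK hGK hH ?_).2
    · exact (weakTransport_real hμ K _ _ (hfK.prod_mk_right_real x) (hhK.prod_mk_right_real x)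
        (hf.prod_mk_right x) fun s t => hhle s t x).2
    · intro x y
      calc ∫ s, g (s, x) ∂μ ≤ ∫ s, (h (s, y) + c x y) ∂μ :=
            integral_mono (hiμ hgK x) ((hiμ hhK y).add (integrable_const _)) fun s => hgh s x y
        _ = _ := by rw [integral_add (hiμ hhK y) (integrable_const _)]; simp

theorem lipschitzWith_finCons (n : ℕ) :
    LipschitzWith 1 (fun q : ℝ × (Fin n → ℝ) => (Fin.cons q.1 q.2 : Fin (n + 1) → ℝ)) := by
  refine LipschitzWith.of_dist_le_mul fun q q' => ?_
  rw [NNReal.coe_one, one_mul, dist_pi_le_iff dist_nonneg, Prod.dist_eq]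
  refine Fin.cases ?_ fun i => ?_
  · simp
  · simpa using Or.inr (dist_le_pi_dist q.2 q'.2 i)

theorem measurePreserving_finCons {n : ℕ} (μ : Fin (n + 1) → Measure ℝ) [∀ i, SigmaFinite (μ i)] :
    MeasurePreserving (fun q : ℝ × (Fin n → ℝ) => (Fin.cons q.1 q.2 : Fin (n + 1) → ℝ))
      ((μ 0).prod (Measure.pi fun j => μ j.succ)) (Measure.pi μ) := by
  have h := (measurePreserving_piFinSuccAbove μ 0).symm
  simp only [Fin.zero_succAbove] at h
  convert h using 1
  funext q
  simp [MeasurableEquiv.piFinSuccAbove, MeasurableEquiv.symm, Fin.consEquiv]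

theorem weakTransport_pi {n : ℕ} {μ : Fin n → Measure ℝ} [∀ i, IsProbabilityMeasure (μ i)]
    (hμ : ∀ i, ∀ᵐ x ∂μ i, x ∈ Set.Icc (0 : ℝ) 1) :
    WeakTransport (fun x y : Fin n → ℝ => ∑ i, (x i - y i) ^ 2 / 2) (Measure.pi μ) := by
  induction n with
  | zero =>
    intro K f g hfK hgK hf hgf
    have h := hgf 0 0
    simp only [Finset.univ_eq_empty, Finset.sum_empty, add_zero] at h
    simp only [Subsingleton.elim _ (0 : Fin 0 → ℝ), integral_const, probReal_univ, one_smul]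
    exact ⟨Real.exp_le_exp.2 h, Real.exp_le_exp.2 (neg_le_neg h)⟩
  | succ n ih =>
    intro K f g hfK hgK hf hgf
    have hmp := measurePreserving_finCons μ
    have hint : ∀ u : (Fin (n + 1) → ℝ) → ℝ, Continuous u →
        ∫ x, u x ∂Measure.pi μ =
          ∫ q, u (Fin.cons q.1 q.2) ∂((μ 0).prod (Measure.pi fun j => μ j.succ)) :=
      fun u hu => by
        rw [← hmp.map_eq, integral_map hmp.measurable.aemeasurable hu.aestronglyMeasurable]
    have hlip : ∀ {u : (Fin (n + 1) → ℝ) → ℝ}, LipschitzWith K u →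
        LipschitzWith K (fun q : ℝ × (Fin n → ℝ) => u (Fin.cons q.1 q.2)) := fun hu => by
      simpa [Function.comp_def] using hu.comp (lipschitzWith_finCons n)
    have hconv : ConvexOn ℝ Set.univ (fun q : ℝ × (Fin n → ℝ) => f (Fin.cons q.1 q.2)) := by
      refine ⟨convex_univ, fun q _ q' _ a b ha hb hab => ?_⟩
      refine le_trans (le_of_eq ?_) (hf.2 (Set.mem_univ (Fin.cons q.1 q.2))
        (Set.mem_univ (Fin.cons q'.1 q'.2)) ha hb hab)
      refine congrArg f (funext fun i => ?_)
      refine Fin.cases ?_ (fun j => ?_) i <;> simp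
    have hgc := hgK.continuous
    have hfc := hfK.continuous
    rw [hint (fun x => Real.exp (g x)) (by fun_prop), hint f hfc,
      hint (fun x => Real.exp (-f x)) (by fun_prop), hint g hgc]
    refine WeakTransport.prod (BoundedlySupported.pi fun j => hμ j.succ)
      (ih fun j => hμ j.succ) (hμ 0) K _ _ (hlip hfK) (hlip hgK) hconv fun q q' => ?_
    simpa [Fin.sum_univ_succ] using hgf (Fin.cons q.1 q.2) (Fin.cons q'.1 q'.2)

/-! ### Sub-Gaussian concentration of convex Lipschitz functions -/

theorem lipschitzWith_const_mul {α : Type*} [PseudoMetricSpace α] {L : ℝ≥0} {f : α → ℝ}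
    (hf : LipschitzWith L f) (t : ℝ≥0) : LipschitzWith (t * L) (fun x => t * f x) := by
  refine LipschitzWith.of_dist_le_mul fun x y => ?_
  have h := hf.dist_le_mul x y
  rw [Real.dist_eq] at h ⊢
  rw [← mul_sub, abs_mul, abs_of_nonneg t.coe_nonneg, NNReal.coe_mul, mul_assoc]
  gcongr

section Concentration

variable {p : ℕ} {f : EuclideanSpace ℝ (Fin p) → ℝ} {L : ℝ≥0}

/-- For the sup norm the constant may depend on `p`; it only serves regularity, while `L` enters
through the cost. -/
theorem exists_lipschitzWith_comp_toLp (hfL : LipschitzWith L f) :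
    ∃ K, LipschitzWith K (fun x : Fin p → ℝ => f (WithLp.toLp 2 x)) :=
  ⟨_, hfL.comp (EuclideanSpace.equiv (Fin p) ℝ).symm.lipschitz⟩

theorem exp_integral_bounds_pi (hf : ConvexOn ℝ Set.univ f) (hfL : LipschitzWith L f)
    {μ : Fin p → Measure ℝ} [∀ i, IsProbabilityMeasure (μ i)]
    (hμ : ∀ i, ∀ᵐ x ∂μ i, x ∈ Set.Icc (0 : ℝ) 1) :
    ∫ x, Real.exp (f (WithLp.toLp 2 x)) ∂Measure.pi μ
        ≤ Real.exp (∫ x, f (WithLp.toLp 2 x) ∂Measure.pi μ + L ^ 2 / 2) ∧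
    ∫ x, Real.exp (-f (WithLp.toLp 2 x)) ∂Measure.pi μ
        ≤ Real.exp (-∫ x, f (WithLp.toLp 2 x) ∂Measure.pi μ + L ^ 2 / 2) := by
  obtain ⟨K, hK⟩ := exists_lipschitzWith_comp_toLp hfL
  have hint := (BoundedlySupported.pi hμ).integrable hK
  have hconv : ConvexOn ℝ Set.univ (fun x : Fin p → ℝ => f (WithLp.toLp 2 x)) :=
    hf.comp_linearMap (WithLp.linearEquiv 2 ℝ (Fin p → ℝ)).symm.toLinearMap
  have hGK : LipschitzWith K (fun x : Fin p → ℝ => f (WithLp.toLp 2 x) - L ^ 2 / 2) :=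
    LipschitzWith.of_le_add_mul K fun x y => by
      have h1 := hK.dist_le_mul x y
      rw [Real.dist_eq] at h1
      linarith [le_abs_self (f (WithLp.toLp 2 x) - f (WithLp.toLp 2 y))]
  obtain ⟨h1, h2⟩ := weakTransport_pi hμ K _ _ hK hGK hconv fun x y => by
    have h1 := hfL.dist_le_mul (WithLp.toLp 2 x) (WithLp.toLp 2 y)
    rw [Real.dist_eq] at h1
    have h2 := le_abs_self (f (WithLp.toLp 2 x) - f (WithLp.toLp 2 y))
    have h3 : ∑ i, (x i - y i) ^ 2 / 2 = dist (WithLp.toLp 2 x) (WithLp.toLp 2 y) ^ 2 / 2 := by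
      rw [← Finset.sum_div, EuclideanSpace.dist_eq, Real.sq_sqrt (by positivity)]
      simp [Real.dist_eq, sq_abs]
    simp only [h3]
    nlinarith [sq_nonneg (dist (WithLp.toLp 2 x) (WithLp.toLp 2 y) - (L : ℝ))]
  constructor
  · simp only [Real.exp_sub, integral_div] at h1
    rwa [div_le_iff₀ (Real.exp_pos _), ← Real.exp_add] at h1
  · rw [integral_sub hint (integrable_const _)] at h2
    simp only [integral_const, probReal_univ, one_smul] at h2
    refine h2.trans (Real.exp_le_exp.2 (le_of_eq ?_))
    ring

theorem hasSubgaussianMGF_pi_of_convexOn (hf : ConvexOn ℝ Set.univ f) (hfL : LipschitzWith L f)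
    {μ : Fin p → Measure ℝ} [∀ i, IsProbabilityMeasure (μ i)]
    (hμ : ∀ i, ∀ᵐ x ∂μ i, x ∈ Set.Icc (0 : ℝ) 1) :
    HasSubgaussianMGF (fun x => f (WithLp.toLp 2 x) - ∫ x, f (WithLp.toLp 2 x) ∂Measure.pi μ)
      (L ^ 2) (Measure.pi μ) := by
  obtain ⟨K, hK⟩ := exists_lipschitzWith_comp_toLp hfL
  have hb := BoundedlySupported.pi hμ
  set m := ∫ x, f (WithLp.toLp 2 x) ∂Measure.pi μ with hm
  have hexp : ∀ t x : ℝ, Real.exp (t * (x - m)) = Real.exp (t * x) * Real.exp (-(t * m)) :=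
    fun t x => by rw [← Real.exp_add]; ring_nf
  constructor
  · intro t
    simp only [hexp]
    refine Integrable.mul_const ?_ _
    rcases le_total 0 t with ht | ht
    · lift t to ℝ≥0 using ht
      exact hb.integrable_exp (lipschitzWith_const_mul hK t)
    -- Negative `t` is written `-s`, as scaling by `s ≥ 0` preserves convexity.
    · obtain ⟨s, rfl⟩ : ∃ s, t = -s := ⟨-t, by ring⟩
      lift s to ℝ≥0 using by linarith
      simp only [neg_mul]
      exact hb.integrable_exp (lipschitzWith_const_mul hK s).neg
  · have key : ∀ t : ℝ≥0,
        ∫ x, Real.exp (t * f (WithLp.toLp 2 x)) ∂Measure.pi μ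
          ≤ Real.exp (t * m + (t * L) ^ 2 / 2) ∧
        ∫ x, Real.exp (-(t * f (WithLp.toLp 2 x))) ∂Measure.pi μ
          ≤ Real.exp (-(t * m) + (t * L) ^ 2 / 2) := fun t => by
      have h := exp_integral_bounds_pi (hf.smul t.coe_nonneg) (lipschitzWith_const_mul hfL t) hμ
      simpa only [smul_eq_mul, integral_const_mul, ← hm, NNReal.coe_mul] using h
    intro t
    simp only [mgf, hexp, integral_mul_const]
    have hmul : ∀ {I a b c : ℝ}, I ≤ Real.exp a → a + b = c → I * Real.exp b ≤ Real.exp c :=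
      fun h hc => by
        rw [← hc, Real.exp_add]
        exact mul_le_mul_of_nonneg_right h (Real.exp_pos _).le
    rcases le_total 0 t with ht | ht
    · lift t to ℝ≥0 using ht
      refine hmul (key t).1 ?_
      push_cast; ring
    · obtain ⟨s, rfl⟩ : ∃ s, t = -s := ⟨-t, by ring⟩
      lift s to ℝ≥0 using by linarith
      simp only [neg_mul]
      refine hmul (key s).2 ?_
      push_cast; ring

/-- A convex or concave Lipschitz function of independent `[0, 1]`-valued variables is
sub-Gaussian, with the square of the Lipschitz constant as variance proxy. -/
theorem hasSubgaussianMGF_of_convexOn_or_concaveOn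
    (hf : ConvexOn ℝ Set.univ f ∨ ConcaveOn ℝ Set.univ f) (hfL : LipschitzWith L f)
    {Ω : Type*} [MeasurableSpace Ω] {P : Measure Ω} [IsProbabilityMeasure P]
    {X : Ω → EuclideanSpace ℝ (Fin p)} (hX : AEMeasurable X P)
    (hXindep : iIndepFun (fun (j : Fin p) (ω : Ω) => X ω j) P)
    (hXsupp : ∀ j : Fin p, ∀ᵐ ω ∂P, X ω j ∈ Set.Icc (0 : ℝ) 1) :
    HasSubgaussianMGF (fun ω => f (X ω) - ∫ ω', f (X ω') ∂P) (L ^ 2) P := by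
  -- Sub-Gaussianity is invariant under a change of sign, so the concave case follows from `-f`.
  wlog hc : ConvexOn ℝ Set.univ f generalizing f
  · have h := this (f := -f) (Or.inl (hf.resolve_left hc).neg) hfL.neg (hf.resolve_left hc).neg
    simpa [Pi.neg_def, integral_neg, neg_add_eq_sub] using h.neg
  have hXj : ∀ j, AEMeasurable (fun ω => X ω j) P := fun j =>
    (EuclideanSpace.proj j : EuclideanSpace ℝ (Fin p) →L[ℝ] ℝ).continuous.measurable.comp_aemeasurable
      hX
  have hXm : AEMeasurable (fun ω j => X ω j) P := aemeasurable_pi_lambda _ hXj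
  have hmap := (iIndepFun_iff_map_fun_eq_pi_map hXj).1 hXindep
  have : ∀ j, IsProbabilityMeasure (P.map fun ω => X ω j) :=
    fun j => Measure.isProbabilityMeasure_map (hXj j)
  have h := hasSubgaussianMGF_pi_of_convexOn hc hfL (μ := fun j => P.map fun ω => X ω j)
    fun j => (ae_map_iff (hXj j) measurableSet_Icc).2 (hXsupp j)
  obtain ⟨K, hK⟩ := exists_lipschitzWith_comp_toLp hfL
  rw [← hmap, integral_map hXm hK.continuous.aestronglyMeasurable] at h
  exact h.of_map hXm

end Concentration

/-- Two-sided Hoeffding inequality for the mean of i.i.d. sub-Gaussian variables. -/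
theorem measureReal_le_abs_mean_sub_le {n : ℕ} (hn : 0 < n) {Ω : Type*} [MeasurableSpace Ω]
    {P : Measure Ω} [IsProbabilityMeasure P] {Y : Fin n → Ω → ℝ} {m : ℝ} {c : ℝ≥0}
    (hY : ∀ i, HasSubgaussianMGF (fun ω => Y i ω - m) c P)
    (hind : iIndepFun Y P) {ε : ℝ} (hε : 0 ≤ ε) :
    P.real {ω | ε ≤ |(∑ i, Y i ω) / (n : ℝ) - m|} ≤ 2 * Real.exp (-(ε ^ 2 * n / (2 * c))) := by
  have hn' : (0 : ℝ) < n := Nat.cast_pos.2 hn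
  have hind' : iIndepFun (fun i ω => Y i ω - m) P :=
    hind.comp (fun _ x => x - m) fun _ => by fun_prop
  have hS := HasSubgaussianMGF.sum_of_iIndepFun hind' (s := Finset.univ) fun i _ => hY i
  have hε' : 0 ≤ n * ε := by positivity
  have h1 := hS.measure_ge_le hε'
  have h2 := hS.neg.measure_ge_le hε'
  have hexp : -(n * ε) ^ 2 / (2 * ((∑ _i : Fin n, c : ℝ≥0) : ℝ)) = -(ε ^ 2 * n / (2 * c)) := by
    simp only [Finset.sum_const, Finset.card_univ, Fintype.card_fin, nsmul_eq_mul,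
      NNReal.coe_mul, NNReal.coe_natCast]
    -- For `c = 0` both exponents are `0`, since division by zero gives `0`.
    rcases eq_or_ne (c : ℝ) 0 with hc | hc
    · simp [hc]
    · field_simp
  rw [hexp] at h1 h2
  have hsub : {ω | ε ≤ |(∑ i, Y i ω) / (n : ℝ) - m|} ⊆
      {ω | n * ε ≤ ∑ i, (Y i ω - m)} ∪ {ω | n * ε ≤ (-fun ω => ∑ i, (Y i ω - m)) ω} := by
    intro ω hω
    have heq : ∑ i, (Y i ω - m) = n * ((∑ i, Y i ω) / (n : ℝ) - m) := by
      rw [Finset.sum_sub_distrib]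
      simp
      field_simp
    simp only [Set.mem_union, Set.mem_ofPred_eq, Pi.neg_apply, heq, ← mul_neg,
      mul_le_mul_iff_right₀ hn']
    exact le_abs.1 hω
  calc _ ≤ _ := measureReal_mono hsub
    _ ≤ _ := measureReal_union_le _ _
    _ ≤ _ := by linarith

theorem proposition2
    {p n : ℕ} (hn : 0 < n)
    {Ω : Type*} [MeasurableSpace Ω] (P : Measure Ω) [IsProbabilityMeasure P]
    {Ω' : Type*} [MeasurableSpace Ω'] (P' : Measure Ω') [IsProbabilityMeasure P']
    -- the integrand: convex or concave, `L`-Lipschitz for the Euclidean norm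
    (f : EuclideanSpace ℝ (Fin p) → ℝ)
    (hf : ConvexOn ℝ Set.univ f ∨ ConcaveOn ℝ Set.univ f)
    (L : ℝ≥0) (hL : 0 < L) (hfL : LipschitzWith L f)
    -- the random vector: independent coordinates, each almost surely in `[0, 1]`
    (X : Ω → EuclideanSpace ℝ (Fin p))
    (hX : AEMeasurable X P)
    (hXindep : iIndepFun (fun (j : Fin p) (ω : Ω) => X ω j) P)
    (hXsupp : ∀ j : Fin p, ∀ᵐ ω ∂P, X ω j ∈ Set.Icc (0 : ℝ) 1)
    -- its independent identically distributed copies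
    (Xs : Fin n → Ω' → EuclideanSpace ℝ (Fin p))
    (hXs_indep : iIndepFun Xs P')
    (hXs_ident : ∀ i : Fin n, IdentDistrib (Xs i) X P' P) :
    Integrable (fun ω => f (X ω)) P ∧
    -- absolute error
    (∀ δ : ℝ, 0 ≤ δ →
      P'.real {ω | δ < |(∑ i, f (Xs i ω)) / (n : ℝ) - ∫ ω', f (X ω') ∂P|}
        ≤ 2 * Real.exp (-(δ ^ 2 * (n : ℝ) / (2 * (L : ℝ) ^ 2)))) ∧
    -- confidence interval
    (∀ α : ℝ, 0 < α → α < 1 →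
      1 - α ≤ P'.real {ω | (∫ ω', f (X ω') ∂P) ∈
        Set.Ioo
          ((∑ i, f (Xs i ω)) / (n : ℝ) - √(2 * Real.log (2 / α) * (L : ℝ) ^ 2 / (n : ℝ)))
          ((∑ i, f (Xs i ω)) / (n : ℝ) + √(2 * Real.log (2 / α) * (L : ℝ) ^ 2 / (n : ℝ)))}) ∧
    -- relative error
    ((∫ ω', f (X ω') ∂P) ≠ 0 → ∀ δ : ℝ, 0 ≤ δ →
      P'.real {ω | δ < |((∑ i, f (Xs i ω)) / (n : ℝ) - ∫ ω', f (X ω') ∂P)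
          / ∫ ω', f (X ω') ∂P|}
        ≤ 2 * Real.exp (-(δ ^ 2 * (n : ℝ) * (∫ ω', f (X ω') ∂P) ^ 2 / (2 * (L : ℝ) ^ 2)))) := by
  have hsub := hasSubgaussianMGF_of_convexOn_or_concaveOn hf hfL hX hXindep hXsupp
  have hfm : Measurable f := hfL.continuous.measurable
  set m := ∫ ω', f (X ω') ∂P with hm
  have hL' : (0 : ℝ) < L := NNReal.coe_pos.2 hL
  have hn' : (0 : ℝ) < n := Nat.cast_pos.2 hn
  -- The event is non-strict so as to be the complement of the open confidence interval.
  have htail : ∀ ε : ℝ, 0 ≤ ε → P'.real {ω | ε ≤ |(∑ i, f (Xs i ω)) / (n : ℝ) - m|}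
      ≤ 2 * Real.exp (-(ε ^ 2 * (n : ℝ) / (2 * (L : ℝ) ^ 2))) := fun ε hε => by
    have h := measureReal_le_abs_mean_sub_le hn (Y := fun i ω => f (Xs i ω)) (m := m)
      (fun i => hsub.congr_identDistrib
        ((hXs_ident i).symm.comp (u := fun x => f x - m) (hfm.sub_const m)))
      (hXs_indep.comp (fun _ => f) fun _ => hfm) hε
    simpa using h
  refine ⟨?_, fun δ hδ => ?_, fun α hα hα1 => ?_, fun hm0 δ hδ => ?_⟩
  · simpa [Pi.add_def] using hsub.integrable.add (integrable_const m)
  · refine (measureReal_mono fun ω hω => ?_).trans (htail δ hδ)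
    rw [Set.mem_ofPred_eq] at hω ⊢
    exact hω.le
  · have hlog : 0 < Real.log (2 / α) := Real.log_pos (by rw [lt_div_iff₀ hα]; linarith)
    set w := √(2 * Real.log (2 / α) * (L : ℝ) ^ 2 / (n : ℝ)) with hw
    -- The half-width makes the tail bound `2 exp (-log (2/α)) = α`.
    have hw2 : w ^ 2 * (n : ℝ) / (2 * (L : ℝ) ^ 2) = Real.log (2 / α) := by
      rw [hw, Real.sq_sqrt (by positivity)]
      field_simp
    have h := htail w (Real.sqrt_nonneg _)
    rw [hw2, Real.exp_neg, Real.exp_log (by positivity), inv_div, mul_div_cancel₀ _ two_ne_zero]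
      at h
    have hcover : (Set.univ : Set Ω') ⊆ {ω | m ∈ Set.Ioo ((∑ i, f (Xs i ω)) / (n : ℝ) - w)
        ((∑ i, f (Xs i ω)) / (n : ℝ) + w)} ∪ {ω | w ≤ |(∑ i, f (Xs i ω)) / (n : ℝ) - m|} := by
      intro ω _
      rcases le_or_gt w |(∑ i, f (Xs i ω)) / (n : ℝ) - m| with h | h
      · exact Or.inr h
      · rw [abs_lt] at h
        exact Or.inl ⟨by linarith, by linarith⟩
    have h1 := (measureReal_mono (μ := P') hcover).trans (measureReal_union_le _ _)
    rw [probReal_univ] at h1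
    linarith
  · have habs : 0 < |m| := abs_pos.2 hm0
    -- A relative error `δ` is an absolute error `δ |m|`.
    have h := htail (δ * |m|) (by positivity)
    rw [mul_pow, sq_abs, mul_right_comm] at h
    refine (measureReal_mono fun ω hω => ?_).trans h
    rw [Set.mem_ofPred_eq, abs_div, lt_div_iff₀ habs] at hω
    exact hω.le
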